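/- For $n\ge 1$ let $S_n$ be the symmetric group on $\{1,\dots,n\}$, and write $\sigma\in S_n$ as the list $[\sigma(1),\dots,\sigma(n)]$. Let $\mathrm{des}(\sigma)$ be the number of indices $i\in\{1,\dots,n-1\}$ with $\sigma(i)>\sigma(i+1)$. A \emph{hook} is a list $[t_1,\dots,t_h]$ of distinct non-zero natural numbers with $h\ge 2$, $t_1>t_2$ and $t_2<t_3<\dots<t_h$. Every list of distinct non-zero natural numbers can be written in exactly one way as a concatenation $p\,\tau_1\cdots\tau_k$ ($k\ge 0$), where $p$ is a (possibly empty) increasing list and each $\tau_i$ is a hook; this is its hook factorization. For $\sigma\in S_n$ with hook factorization $p\,\tau_1\cdots\tau_k$ put $\mathrm{lec}(\sigma)=\sum_{i=1}^k|\mathrm{inv}(\tau_i)|$, where $\mathrm{inv}(\tau)$ is the set of pairs of positions $i<j$ of the list $\tau$ whose entries satisfy $\tau(i)>\tau(j)$. In $\mathbb{Q}[q][[t]]$ define \[ \mathcal{L}(q,t)=\sum_{n\ge1}\Bigl(\sum_{\sigma\in S_n}q^{\mathrm{lec}(\sigma)}\Bigr)\frac{t^n}{n!},\qquad \mathcal{E}(q,t)=\sum_{n\ge1}\Bigl(\sum_{\sigma\in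 S_n}q^{\mathrm{des}(\sigma)}\Bigr)\frac{t^n}{n!}. \] Then $\mathcal{L}(q,t)=\mathcal{E}(q,t)$. Consequently $\mathrm{lec}$ and $\mathrm{des}$ are equidistributed: for all $n$ and $k$, the number of $\sigma\in S_n$ with $\mathrm{lec}(\sigma)=k$ equals the number of $\sigma\in S_n$ with $\mathrm{des}(\sigma)=k$, i.e. $\mathrm{lec}$ is an Eulerian statistic. -/

import Mathlib

namespace LecDes

/-- The set of inversions of a list `[l₀, l₁, …]`: the pairs of positions `i < j` with `l_i > l_j`. -/
def inversions (l : List ℕ) : Finset (Fin l.length × Fin l.length) :=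
  Finset.univ.filter fun p => p.1 < p.2 ∧ l.get p.2 < l.get p.1

/-- A hook is a list `[t₁, …, t_h]` of distinct non-zero natural numbers with `h ≥ 2`, `t₁ > t₂`
and `t₂ < t₃ < ⋯ < t_h`. -/
def IsHook : List ℕ → Prop
  | t₁ :: t₂ :: ts =>
      (t₁ :: t₂ :: ts).Nodup ∧ (∀ x ∈ t₁ :: t₂ :: ts, x ≠ 0) ∧ t₂ < t₁ ∧
        (t₂ :: ts).Pairwise (· < ·)
  | _ => False

/-- `(p, [τ₁, …, τ_k])` is a hook factorization of `l`: `l` is the concatenation `p τ₁ ⋯ τ_k`,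
the list `p` is (possibly empty and) increasing, and every `τ_i` is a hook. -/
def IsHookFactorization (l : List ℕ) (F : List ℕ × List (List ℕ)) : Prop :=
  l = F.1 ++ F.2.flatten ∧ F.1.Pairwise (· < ·) ∧ ∀ τ ∈ F.2, IsHook τ

/-- Prepend a letter to a word `p τ₁ ⋯ τ_k` given by its hook factorization. -/
def consHook (a : ℕ) : List ℕ × List (List ℕ) → List ℕ × List (List ℕ)
  | ([], τs) => ([a], τs)
  | (b :: p, τs) => if a < b then (a :: b :: p, τs) else ([], (a :: b :: p) :: τs)

/-- The hook factorization of a list, read from right to left. That it is the unique hook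
factorization of a list of distinct non-zero numbers is `isHookFactorization_iff` below. -/
def hookFactorization (l : List ℕ) : List ℕ × List (List ℕ) :=
  l.foldr consHook ([], [])

theorem isHookFactorization_hookFactorization (l : List ℕ) (hl : l.Nodup) (h0 : ∀ x ∈ l, x ≠ 0) :
    IsHookFactorization l (hookFactorization l) := by
  induction l with
  | nil => simp [hookFactorization, IsHookFactorization]
  | cons a l ih =>
    obtain ⟨h1, h2, h3⟩ := ih hl.of_cons (fun x hx => h0 x (List.mem_cons_of_mem _ hx))
    change IsHookFactorization (a :: l) (consHook a (hookFactorization l))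
    generalize hookFactorization l = F at h1 h2 h3
    obtain ⟨p, τs⟩ := F
    dsimp only at h1 h2 h3
    subst h1
    cases p with
    | nil => exact ⟨rfl, List.pairwise_singleton _ a, h3⟩
    | cons b p =>
      simp only [consHook]
      split_ifs with hab
      · refine ⟨rfl, ?_, h3⟩
        refine List.pairwise_cons.2 ⟨fun x hx => ?_, h2⟩
        rcases List.mem_cons.1 hx with rfl | hx
        · exact hab
        · exact hab.trans ((List.pairwise_cons.1 h2).1 x hx)
      · refine ⟨by simp, by simp, ?_⟩
        intro τ hτ
        rcases List.mem_cons.1 hτ with rfl | hτ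
        · refine ⟨?_, ?_, ?_, h2⟩
          · exact hl.sublist (by simp)
          · intro x hx
            apply h0
            simp only [List.mem_cons, List.mem_append] at hx ⊢
            tauto
          · have : a ≠ b := by
              rintro rfl
              simp at hl
            omega
        · exact h3 τ hτ

theorem IsHookFactorization.eq_hookFactorization {l : List ℕ} {F : List ℕ × List (List ℕ)}
    (hF : IsHookFactorization l F) : hookFactorization l = F := by
  have inc : ∀ (p : List ℕ) (τs : List (List ℕ)), p.Pairwise (· < ·) →
      p.foldr consHook ([], τs) = (p, τs) := by
    intro p τs hp
    induction p with
    | nil => rfl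
    | cons a p ih =>
      rw [List.foldr_cons, ih hp.of_cons]
      cases p with
      | nil => rfl
      | cons b p =>
        have : a < b := (List.pairwise_cons.1 hp).1 b (by simp)
        simp [consHook, this]
  have hooks : ∀ τs : List (List ℕ), (∀ τ ∈ τs, IsHook τ) →
      τs.flatten.foldr consHook ([], []) = ([], τs) := by
    intro τs hτ
    induction τs with
    | nil => rfl
    | cons τ τs ih =>
      rw [List.flatten_cons, List.foldr_append, ih (fun x hx => hτ x (List.mem_cons_of_mem _ hx))]
      have h := hτ τ (by simp)
      match τ, h with
      | a :: b :: ts, h =>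
        obtain ⟨-, -, h1, h2⟩ := h
        rw [List.foldr_cons, inc _ _ h2]
        simp [consHook, h1.not_gt]
  obtain ⟨p, τs⟩ := F
  obtain ⟨rfl, h2, h3⟩ := hF
  rw [hookFactorization, List.foldr_append, hooks _ h3, inc _ _ h2]

/-- Existence and uniqueness of the hook factorization. -/
theorem isHookFactorization_iff (l : List ℕ) (hl : l.Nodup) (h0 : ∀ x ∈ l, x ≠ 0)
    (F : List ℕ × List (List ℕ)) : IsHookFactorization l F ↔ F = hookFactorization l :=
  ⟨fun h => h.eq_hookFactorization.symm,
    fun h => h ▸ isHookFactorization_hookFactorization l hl h0⟩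

/-- The one-line notation `[σ(1), …, σ(n)]` of `σ ∈ S_n`, with values in `{1, …, n}`. -/
def oneLine {n : ℕ} (σ : Equiv.Perm (Fin n)) : List ℕ :=
  List.ofFn fun i => (σ i : ℕ) + 1

/-- `lec σ` is the sum of the numbers of inversions of the hooks `τ₁, …, τ_k` in the hook
factorization `p τ₁ ⋯ τ_k` of `[σ(1), …, σ(n)]`. -/
def lec {n : ℕ} (σ : Equiv.Perm (Fin n)) : ℕ :=
  ((hookFactorization (oneLine σ)).2.map fun τ => (inversions τ).card).sum

/-- `des σ` is the number of descents of `σ`: positions `i` with `i + 1` also a position and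
`σ(i) > σ(i + 1)`. -/
def des {n : ℕ} (σ : Equiv.Perm (Fin n)) : ℕ :=
  (Finset.univ.filter fun i : Fin n => ∃ h : (i : ℕ) + 1 < n, σ ⟨(i : ℕ) + 1, h⟩ < σ i).card

/-- The exponential generating function `∑_{n ≥ 1} (∑_{σ ∈ S_n} q ^ stat σ) t ^ n / n!` of a
statistic on the symmetric groups, as an element of `ℚ[q]⟦t⟧`. -/
noncomputable def statEGF (stat : ∀ n : ℕ, Equiv.Perm (Fin n) → ℕ) : PowerSeries (Polynomial ℚ) :=
  PowerSeries.mk fun n =>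
    if n = 0 then 0
    else Polynomial.C ((n.factorial : ℚ)⁻¹) *
      ∑ σ : Equiv.Perm (Fin n), (Polynomial.X : Polynomial ℚ) ^ stat n σ

/-- The series `𝓛(q,t)` of the statistic `lec`. -/
noncomputable def lecEGF : PowerSeries (Polynomial ℚ) := statEGF fun _ σ => lec σ

/-- The series `𝓔(q,t)` of the statistic `des`. -/
noncomputable def desEGF : PowerSeries (Polynomial ℚ) := statEGF fun _ σ => des σ

end LecDes

namespace LecDes

open Polynomial

/-! ### Arrangements of a finite set -/

/-! Write `L` and `D` for the exponential generating functions of `lec` and `des`, with constant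
term 1 for the empty word, and compare equations obtained by cutting words in two. For `lec`: a word
is increasing, or it is a word followed by its last hook (`pow_listLec_eq`). Hence `L = e^t + L H`,
where `(q - 1) H = e^{qt} - q e^t + q - 1` by a geometric sum (`sum_arrangements_hookWeight`). For
`des`: weighting each increasing prefix of length `h` by `(1 - q)^h` gives a telescoping sum
(`sum_increasing_prefix_listDes`). Hence `q K D = D + (q - 1) K` with `K = e^{(1-q)t}`. Since `e^t =
e^{qt} K`, the equation for `L` is `e^{qt}` times the one for `D`. Both series equal `(q - 1) K / (q
K - 1)`. The cuts split a set into two arbitrary subsets, so the recurrences are first proved for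
sums over arrangements of any finite set of positive integers (`arrangementSum_listLec`,
`arrangementSum_listDes`). -/

/-- The lists that enumerate the finite set `s` without repetition. -/
noncomputable def arrangements (s : Finset ℕ) : Finset (List ℕ) :=
  s.toList.permutations.toFinset

theorem mem_arrangements {s : Finset ℕ} {l : List ℕ} :
    l ∈ arrangements s ↔ l.Nodup ∧ l.toFinset = s := by
  rw [arrangements, List.mem_toFinset, List.mem_permutations]
  constructor
  · intro h
    exact ⟨h.nodup_iff.2 s.nodup_toList, by rw [List.toFinset_eq_of_perm _ _ h, s.toList_toFinset]⟩
  · rintro ⟨h, rfl⟩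
    exact (List.toFinset_toList h).symm

theorem card_arrangements (s : Finset ℕ) : (arrangements s).card = s.card.factorial := by
  rw [arrangements, List.toFinset_card_of_nodup (List.nodup_permutations _ s.nodup_toList),
    List.length_permutations, Finset.length_toList]

theorem length_of_mem_arrangements {s : Finset ℕ} {l : List ℕ} (h : l ∈ arrangements s) :
    l.length = s.card := by
  obtain ⟨h1, rfl⟩ := mem_arrangements.1 h
  exact (List.toFinset_card_of_nodup h1).symm

theorem ne_zero_of_mem_arrangements {s : Finset ℕ} (hs : 0 ∉ s) {l : List ℕ}
    (h : l ∈ arrangements s) : ∀ x ∈ l, x ≠ 0 := by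
  obtain ⟨-, rfl⟩ := mem_arrangements.1 h
  rintro x hx rfl
  exact hs (List.mem_toFinset.2 hx)

/-- Cutting an arrangement of `s` at every position produces every pair of arrangements of
complementary subsets of `s` exactly once. -/
theorem sum_arrangements_take_drop {M : Type*} [AddCommMonoid M] (s : Finset ℕ)
    (f : List ℕ → List ℕ → M) :
    ∑ l ∈ arrangements s, ∑ h ∈ Finset.range (s.card + 1), f (l.take h) (l.drop h) =
      ∑ B ∈ s.powerset, ∑ u ∈ arrangements B, ∑ v ∈ arrangements (s \ B), f u v := by
  simp_rw [← Finset.sum_product', Finset.sum_sigma']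
  refine Finset.sum_bij'
    (fun (x : List ℕ × ℕ) _ =>
      (⟨(x.1.take x.2).toFinset, (x.1.take x.2, x.1.drop x.2)⟩ : (_ : Finset ℕ) × (List ℕ × List ℕ)))
    (fun y _ => (y.2.1 ++ y.2.2, y.2.1.length)) ?_ ?_ ?_ ?_ ?_
  · rintro ⟨l, h⟩ hx
    simp only [Finset.mem_product, Finset.mem_range, mem_arrangements] at hx
    obtain ⟨⟨hl, rfl⟩, -⟩ := hx
    simp only [Finset.mem_sigma, Finset.mem_powerset, Finset.mem_product, mem_arrangements]
    have hl' := hl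
    rw [← List.take_append_drop h l] at hl'
    refine ⟨fun x hx => ?_, ⟨hl.sublist (List.take_sublist _ _), trivial⟩,
      hl.sublist (List.drop_sublist _ _), ?_⟩
    · rw [List.mem_toFinset] at hx ⊢
      exact List.mem_of_mem_take hx
    · have hdis := List.disjoint_toFinset_iff_disjoint.2 (List.nodup_append'.1 hl').2.2
      have hun : l.toFinset = (l.take h).toFinset ∪ (l.drop h).toFinset := by
        rw [← List.toFinset_append, List.take_append_drop]
      rw [hun, Finset.union_sdiff_cancel_left hdis]
  · rintro ⟨B, u, v⟩ hy
    simp only [Finset.mem_sigma, Finset.mem_powerset, Finset.mem_product, mem_arrangements] at hy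
    obtain ⟨hB, ⟨hu, rfl⟩, hv, hvs⟩ := hy
    simp only [Finset.mem_product, Finset.mem_range, mem_arrangements]
    have hdis : Disjoint u.toFinset v.toFinset := by
      rw [hvs]; exact Finset.disjoint_sdiff
    refine ⟨⟨List.nodup_append'.2 ⟨hu, hv, List.disjoint_toFinset_iff_disjoint.1 hdis⟩, ?_⟩, ?_⟩
    · rw [List.toFinset_append, hvs, Finset.union_sdiff_of_subset hB]
    · rw [← List.toFinset_card_of_nodup hu]
      exact Nat.lt_succ_of_le (Finset.card_le_card hB)
  · rintro ⟨l, h⟩ hx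
    simp only [Finset.mem_product, Finset.mem_range] at hx
    have := length_of_mem_arrangements hx.1
    simp only [List.take_append_drop, List.length_take, Prod.mk.injEq, true_and]
    omega
  · rintro ⟨B, u, v⟩ hy
    simp only [Finset.mem_sigma, Finset.mem_product, mem_arrangements] at hy
    obtain ⟨-, ⟨hu, rfl⟩, -⟩ := hy
    simp
  · rintro ⟨l, h⟩ hx
    rfl

theorem eq_sort_iff_of_mem_arrangements {s : Finset ℕ} {l : List ℕ} (h : l ∈ arrangements s) :
    l.Pairwise (· < ·) ↔ l = s.sort := by
  obtain ⟨h1, h2⟩ := mem_arrangements.1 h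
  constructor
  · intro hl
    subst h2
    exact ((List.toFinset_sort (r := (· ≤ ·)) h1).2 (hl.imp fun h => h.le)).symm
  · rintro rfl
    exact (Finset.sortedLT_sort s).pairwise

theorem sort_mem_arrangements (s : Finset ℕ) : s.sort ∈ arrangements s :=
  mem_arrangements.2 ⟨s.sort_nodup _, s.sort_toFinset _⟩

/-- A finite set has exactly one increasing arrangement. -/
theorem sum_arrangements_increasing {M : Type*} [AddCommMonoid M] (s : Finset ℕ) (g : ℕ → M) :
    ∑ l ∈ arrangements s, (if l.Pairwise (· < ·) then g l.length else 0) = g s.card := by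
  rw [Finset.sum_eq_single_of_mem _ (sort_mem_arrangements s)]
  · rw [if_pos (Finset.sortedLT_sort s).pairwise, Finset.length_sort]
  · intro l hl hne
    rw [if_neg fun h => hne ((eq_sort_iff_of_mem_arrangements hl).1 h)]

/-! ### Descents -/

/-- The number of descents of a list. -/
def listDes : List ℕ → ℕ
  | [] => 0
  | [_] => 0
  | a :: b :: l => (if b < a then 1 else 0) + listDes (b :: l)

/-- Arbitrary functions are allowed because deleting the first letter of a permutation does not
leave a permutation. -/
theorem card_descents_eq_listDes {n : ℕ} (f : Fin n → ℕ) :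
    (Finset.univ.filter fun i : Fin n => ∃ h : (i : ℕ) + 1 < n, f ⟨(i : ℕ) + 1, h⟩ < f i).card =
      listDes (List.ofFn f) := by
  induction n with
  | zero => simp [listDes]
  | succ n ih =>
    cases n with
    | zero =>
      rw [List.ofFn_succ, List.ofFn_zero, listDes, Finset.card_eq_zero]
      refine Finset.filter_false_of_mem ?_
      rintro i - ⟨h, -⟩
      omega
    | succ n =>
      rw [Fin.card_filter_univ_succ']
      rw [List.ofFn_succ, List.ofFn_succ, listDes, ← List.ofFn_succ (f := fun i => f i.succ), ← ih]
      congr 1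
      · refine if_congr ⟨fun ⟨_, h⟩ => h, fun h => ⟨Nat.succ_lt_succ n.succ_pos, h⟩⟩ rfl rfl
      · congr 1
        ext i
        simp [Fin.succ]

theorem des_eq_listDes {n : ℕ} (σ : Equiv.Perm (Fin n)) : des σ = listDes (oneLine σ) := by
  rw [oneLine, ← card_descents_eq_listDes, des]
  simp

/-- The increasing prefixes of `l`, weighted by powers of `1 - q`, telescope. -/
theorem sum_increasing_prefix_listDes (l : List ℕ) (hl : l.Nodup) :
    (X : ℚ[X]) * ∑ h ∈ Finset.range (l.length + 1),
        (if (l.take h).Pairwise (· < ·) then (1 - X) ^ (l.take h).length else 0) *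
          X ^ listDes (l.drop h) =
      X ^ listDes l + if l.Pairwise (· < ·) then (X - 1) * (1 - X) ^ l.length else 0 := by
  induction l with
  | nil => simp [listDes]
  | cons a l ih =>
    specialize ih hl.of_cons
    rw [List.length_cons, Finset.sum_range_succ']
    simp only [List.take_succ_cons, List.drop_succ_cons, List.take_zero, List.drop_zero,
      List.Pairwise.nil, if_true, List.length_nil, pow_zero, one_mul]
    cases l with
    | nil => simp [listDes]; ring
    | cons b l =>
      by_cases hab : a < b
      · have key : ∀ l' : List ℕ, l' <+: b :: l →
            ((a :: l').Pairwise (· < ·) ↔ l'.Pairwise (· < ·)) := by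
          intro l' hl'
          refine ⟨fun h => h.of_cons, fun h => List.pairwise_cons.2 ⟨fun x hx => ?_, h⟩⟩
          cases l' with
          | nil => simp at hx
          | cons c l' =>
            obtain rfl := (List.cons_prefix_cons.1 hl').1
            rcases List.mem_cons.1 hx with rfl | hx
            · exact hab
            · exact hab.trans ((List.pairwise_cons.1 h).1 x hx)
        simp only [key _ (List.take_prefix _ _), key _ (List.prefix_refl _)]
        have hsum : ∑ h ∈ Finset.range ((b :: l).length + 1),
            (if ((b :: l).take h).Pairwise (· < ·) then
              (1 - X : ℚ[X]) ^ (a :: (b :: l).take h).length else 0) *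
              X ^ listDes ((b :: l).drop h) = (1 - X) * ∑ h ∈ Finset.range ((b :: l).length + 1),
            (if ((b :: l).take h).Pairwise (· < ·) then
              (1 - X : ℚ[X]) ^ ((b :: l).take h).length else 0) *
              X ^ listDes ((b :: l).drop h) := by
          rw [Finset.mul_sum]
          refine Finset.sum_congr rfl fun h _ => ?_
          split_ifs
          · rw [List.length_cons, pow_succ]; ring
          · simp
        -- At an ascent, each nonempty prefix is `a` followed by a prefix of the tail, which costs a
        -- factor `1 - X`; the empty prefix supplies the remaining `X`.
        rw [hsum, mul_add, mul_left_comm, ih]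
        simp only [listDes, hab.not_gt, if_false, zero_add]
        split_ifs
        · rw [pow_succ (1 - X : ℚ[X]) (b :: l).length]; ring
        · ring
      · have hba : b < a := by
          have : a ≠ b := by rintro rfl; simp at hl
          omega
        -- At a descent only the prefixes `[]` and `[a]` are increasing; their weights `X` and `1 -
        -- X` add up to 1.
        rw [Finset.sum_eq_single_of_mem 0 (by simp)]
        · rw [if_neg (c := List.Pairwise _ (a :: b :: l))]
          · simp [listDes, hba]; ring
          · intro h; exact hab ((List.pairwise_cons.1 h).1 b (by simp))
        · rintro (_ | h) - h0
          · exact absurd rfl h0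
          · have : ¬ (a :: (b :: l).take (h + 1)).Pairwise (· < ·) :=
              fun h => hab ((List.pairwise_cons.1 h).1 b (by simp))
            simp only [this, if_false, zero_mul]

/-! ### Hooks -/

/-- The statistic `lec` of a list. -/
def listLec (l : List ℕ) : ℕ :=
  ((hookFactorization l).2.map fun τ => (inversions τ).card).sum

open Classical in
/-- The weight `q ^ inv v` of a hook `v`, extended by zero to all lists. -/
noncomputable def hookWeight (v : List ℕ) : ℚ[X] :=
  if IsHook v then X ^ (inversions v).card else 0

theorem hookFactorization_of_increasing {l : List ℕ} (h : l.Pairwise (· < ·)) :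
    hookFactorization l = (l, []) :=
  IsHookFactorization.eq_hookFactorization ⟨by simp, h, by simp⟩

theorem hookFactorization_append {u v : List ℕ} (hu : u.Nodup) (h0 : ∀ x ∈ u, x ≠ 0)
    (hv : IsHook v) : hookFactorization (u ++ v) =
      ((hookFactorization u).1, (hookFactorization u).2 ++ [v]) := by
  obtain ⟨h1, h2, h3⟩ := isHookFactorization_hookFactorization u hu h0
  refine IsHookFactorization.eq_hookFactorization ⟨?_, h2, ?_⟩
  · conv_lhs => rw [h1]
    simp
  · intro τ hτ
    rcases List.mem_append.1 hτ with hτ | hτ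
    · exact h3 τ hτ
    · rw [List.mem_singleton.1 hτ]; exact hv

/-- A list is either increasing or ends in exactly one hook of its hook factorization. -/
theorem pow_listLec_eq (l : List ℕ) (hl : l.Nodup) (h0 : ∀ x ∈ l, x ≠ 0) :
    (X : ℚ[X]) ^ listLec l = (if l.Pairwise (· < ·) then 1 else 0) +
      ∑ h ∈ Finset.range (l.length + 1), X ^ listLec (l.take h) * hookWeight (l.drop h) := by
  -- By uniqueness of the factorization, a suffix that is a hook must be the last hook, so at most
  -- one cut contributes.
  have key : ∀ h, IsHook (l.drop h) → hookFactorization l =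
      ((hookFactorization (l.take h)).1, (hookFactorization (l.take h)).2 ++ [l.drop h]) := by
    intro h hh
    conv_lhs => rw [← List.take_append_drop h l]
    exact hookFactorization_append (hl.sublist (List.take_sublist _ _))
      (fun x hx => h0 x (List.mem_of_mem_take hx)) hh
  obtain ⟨h1, h2, h3⟩ := isHookFactorization_hookFactorization l hl h0
  rcases List.eq_nil_or_concat' (hookFactorization l).2 with hF | ⟨τs, τ, hF⟩
  · rw [hF, List.flatten_nil, List.append_nil] at h1
    rw [← h1] at h2
    rw [if_pos h2, Finset.sum_eq_zero, listLec, hF]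
    · simp
    · intro h _
      rw [hookWeight, if_neg, mul_zero]
      intro hh
      rw [key h hh] at hF
      simp at hF
  · have hτ : IsHook τ := h3 τ (by rw [hF]; simp)
    set u := (hookFactorization l).1 ++ τs.flatten with hu
    have hlu : l = u ++ τ := by
      rw [hF] at h1
      rw [hu]
      simpa using h1
    have ht : l.take u.length = u := by rw [hlu]; simp
    have hd : l.drop u.length = τ := by rw [hlu]; simp
    rw [if_neg, zero_add, Finset.sum_eq_single_of_mem u.length]
    · rw [hd, hookWeight, if_pos hτ, ← pow_add]
      have := key u.length (by rw [hd]; exact hτ)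
      rw [listLec, this, hd]
      simp [listLec]
    · rw [Finset.mem_range, hlu]; simp
    · intro h hh hne
      rw [hookWeight, if_neg, mul_zero]
      intro hk
      have h4 := congrArg Prod.snd (key h hk)
      rw [hF] at h4
      have h5 := (List.append_inj' h4 rfl).2
      have h6 := congrArg List.length (List.singleton_inj.1 h5)
      rw [List.length_drop] at h6
      have h7 := congrArg List.length hlu
      rw [List.length_append] at h7
      rw [Finset.mem_range] at hh
      omega
    · intro h
      rw [hookFactorization_of_increasing h] at hF
      simp at hF

/-- As the tail increases, every inversion starts at position 0. -/
theorem card_inversions_cons {a : ℕ} {l : List ℕ} (hl : l.Pairwise (· < ·)) :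
    (inversions (a :: l)).card = (l.toFinset.filter (· < a)).card := by
  have h1 : l.toFinset.filter (· < a) =
      (Finset.univ.filter fun j : Fin l.length => l.get j < a).image l.get := by
    ext x
    simp only [Finset.mem_filter, List.mem_toFinset, Finset.mem_image, Finset.mem_univ, true_and]
    constructor
    · rintro ⟨hx, hxa⟩
      obtain ⟨j, rfl⟩ := List.mem_iff_get.1 hx
      exact ⟨j, hxa, rfl⟩
    · rintro ⟨j, hj, rfl⟩
      exact ⟨List.get_mem l j, hj⟩
  have h2 : inversions (a :: l) = (Finset.univ.filter fun j : Fin l.length => l.get j < a).image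
      (fun j => ((0 : Fin (l.length + 1)), j.succ)) := by
    ext ⟨i, j⟩
    simp only [inversions, Finset.mem_filter, Finset.mem_image, Finset.mem_univ, true_and,
      Prod.mk.injEq]
    constructor
    · rintro ⟨hij, hlt⟩
      obtain ⟨j, rfl⟩ := Fin.exists_succ_eq.2 (Fin.pos_iff_ne_zero.1 (i.zero_le.trans_lt hij))
      rcases Fin.eq_zero_or_eq_succ i with rfl | ⟨i, rfl⟩
      · exact ⟨j, hlt, rfl, rfl⟩
      · exact absurd hlt (List.pairwise_iff_get.1 hl i j (Fin.succ_lt_succ_iff.1 hij)).not_gt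
    · rintro ⟨j, hj, rfl, rfl⟩
      exact ⟨Fin.succ_pos j, hj⟩
  have hnd : l.Nodup := hl.imp fun h => h.ne
  rw [h1, h2, Finset.card_image_of_injective _ (List.nodup_iff_injective_get.1 hnd),
    Finset.card_image_of_injective]
  intro x y h
  exact Fin.succ_injective _ (Prod.mk.inj h).2

/-- The exponent is the rank of `a` in `B`, and only rank 0 is left out, so the sum is `q + ⋯ +
q^(m-1)` with `m = B.card`. The last term corrects the closed form at `m = 0`. In the induction, a
new maximum leaves all other ranks unchanged. -/
theorem sum_pow_card_filter_lt (B : Finset ℕ) :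
    (X - 1 : ℚ[X]) * ∑ a ∈ B.filter (fun a => ∃ b ∈ B, b < a), X ^ (B.filter (· < a)).card =
      X ^ B.card - X + if B.card = 0 then X - 1 else 0 := by
  induction B using Finset.induction_on_max with
  | empty => simp
  | insert m B hm ih =>
    have hmB : m ∉ B := fun h => (hm m h).false
    have hlt : ∀ a ∈ B, (insert m B).filter (· < a) = B.filter (· < a) := by
      intro a ha
      rw [Finset.filter_insert, if_neg (hm a ha).not_gt]
    have hfm : (insert m B).filter (· < m) = B := by
      rw [Finset.filter_insert, if_neg (lt_irrefl m), Finset.filter_true_of_mem hm]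
    rw [Finset.sum_filter] at ih ⊢
    rw [Finset.sum_insert hmB, hfm, Finset.card_insert_of_notMem hmB]
    have : ∑ a ∈ B, (if ∃ b ∈ insert m B, b < a then
        (X : ℚ[X]) ^ ((insert m B).filter (· < a)).card else 0) =
        ∑ a ∈ B, (if ∃ b ∈ B, b < a then (X : ℚ[X]) ^ (B.filter (· < a)).card else 0) := by
      refine Finset.sum_congr rfl fun a ha => ?_
      rw [hlt a ha]
      refine if_congr ?_ rfl rfl
      simp [(hm a ha).not_gt]
    rw [this, mul_add, ih]
    rcases B.eq_empty_or_nonempty with rfl | ⟨b, hb⟩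
    · simp
    · rw [if_pos ⟨b, Finset.mem_insert_of_mem hb, hm b hb⟩]
      have : B.card ≠ 0 := Finset.card_ne_zero_of_mem hb
      simp [this]
      ring

/-- The hooks with underlying set `B`, counted by inversions: a hook is determined by its first
letter, which is any element of `B` but the smallest. -/
theorem sum_arrangements_hookWeight (B : Finset ℕ) (hB : 0 ∉ B) :
    (X - 1 : ℚ[X]) * ∑ v ∈ arrangements B, hookWeight v =
      X ^ B.card - X + if B.card = 0 then X - 1 else 0 := by
  classical
  rw [← sum_pow_card_filter_lt]
  congr 1
  simp only [hookWeight]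
  rw [← Finset.sum_filter]
  have hook : ∀ v ∈ (arrangements B).filter IsHook, ∃ a ∈ B, (∃ b ∈ B, b < a) ∧
      v = a :: (B.erase a).sort := by
    intro v hv
    rw [Finset.mem_filter] at hv
    obtain ⟨hvB, hv⟩ := hv
    match v, hvB, hv with
    | a :: b :: ts, hvB, ⟨h1, h2, h3, h4⟩ =>
      obtain ⟨-, rfl⟩ := mem_arrangements.1 hvB
      refine ⟨a, by simp, ⟨b, by simp, h3⟩, ?_⟩
      have ha : a ∉ (b :: ts).toFinset := by
        rw [List.mem_toFinset]; exact (List.nodup_cons.1 h1).1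
      rw [List.toFinset_cons, Finset.erase_insert ha]
      congr 1
      exact (eq_sort_iff_of_mem_arrangements (mem_arrangements.2 ⟨h1.of_cons, rfl⟩)).1 h4
  refine Finset.sum_bij' (fun v _ => v.headI) (fun a _ => a :: (B.erase a).sort) ?_ ?_ ?_ ?_ ?_
  · intro v hv
    obtain ⟨a, ha, hb, rfl⟩ := hook v hv
    exact Finset.mem_filter.2 ⟨ha, hb⟩
  · intro a ha
    obtain ⟨ha, b, hb, hba⟩ := Finset.mem_filter.1 ha
    have hnd : (a :: (B.erase a).sort).Nodup := by
      simp [Finset.sort_nodup]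
    have hmem : a :: (B.erase a).sort ∈ arrangements B := by
      refine mem_arrangements.2 ⟨hnd, ?_⟩
      rw [List.toFinset_cons, Finset.sort_toFinset, Finset.insert_erase ha]
    refine Finset.mem_filter.2 ⟨hmem, ?_⟩
    have hb' : b ∈ (B.erase a).sort := by simp [hb, hba.ne]
    have hsort := (Finset.sortedLT_sort (B.erase a)).pairwise
    have h0 := ne_zero_of_mem_arrangements hB hmem
    cases hl : (B.erase a).sort with
    | nil => rw [hl] at hb'; simp at hb'
    | cons c l =>
      rw [hl] at hb' hsort h0 hnd
      refine ⟨hnd, h0, ?_, hsort⟩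
      rcases List.mem_cons.1 hb' with rfl | hb'
      · exact hba
      · exact ((List.pairwise_cons.1 hsort).1 b hb').trans hba
  · intro v hv
    obtain ⟨a, ha, hb, rfl⟩ := hook v hv
    rfl
  · intro a ha
    rfl
  · intro v hv
    obtain ⟨a, ha, hb, rfl⟩ := hook v hv
    rw [card_inversions_cons (Finset.sortedLT_sort _).pairwise, Finset.sort_toFinset]
    change _ = (X : ℚ[X]) ^ (B.filter (· < a)).card
    congr 2
    ext x
    simp only [Finset.mem_filter, Finset.mem_erase]
    exact ⟨fun h => ⟨h.1.2, h.2⟩, fun h => ⟨⟨h.2.ne, h.1⟩, h.2⟩⟩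

/-! ### Recurrences for the weighted sums over arrangements -/

theorem sum_powerset_sdiff {M : Type*} [AddCommMonoid M] (s : Finset ℕ)
    (g : Finset ℕ → Finset ℕ → M) :
    ∑ B ∈ s.powerset, g B (s \ B) = ∑ B ∈ s.powerset, g (s \ B) B := by
  refine Finset.sum_nbij' (s \ ·) (s \ ·) ?_ ?_ ?_ ?_ ?_
  · intro B _; exact Finset.mem_powerset.2 Finset.sdiff_subset
  · intro B _; exact Finset.mem_powerset.2 Finset.sdiff_subset
  · intro B hB; exact Finset.sdiff_sdiff_eq_self (Finset.mem_powerset.1 hB)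
  · intro B hB; exact Finset.sdiff_sdiff_eq_self (Finset.mem_powerset.1 hB)
  · intro B hB; simp only [Finset.sdiff_sdiff_eq_self (Finset.mem_powerset.1 hB)]

/-- The sum of `q ^ stat l` over the arrangements `l` of `s`. -/
noncomputable def arrangementSum (stat : List ℕ → ℕ) (s : Finset ℕ) : ℚ[X] :=
  ∑ l ∈ arrangements s, X ^ stat l

/-- The telescoping identity summed over all arrangements of `s`, with `B` the letters of the
prefix. It is rearranged so that the coefficient at `B = ∅` vanishes, as `egf_recurrence` requires.
-/
theorem arrangementSum_listDes (s : Finset ℕ) :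
    (X - 1) * arrangementSum listDes s = (X - 1) * (1 - X) ^ s.card +
      ∑ B ∈ s.powerset, ((if B.card = 0 then X else 0) - X * (1 - X) ^ B.card) *
        arrangementSum listDes (s \ B) := by
  have h1 := sum_arrangements_take_drop s fun u v =>
    (if u.Pairwise (· < ·) then (1 - X : ℚ[X]) ^ u.length else 0) * X ^ listDes v
  simp_rw [← Finset.mul_sum, ← Finset.sum_mul,
    sum_arrangements_increasing _ (fun k => (1 - X : ℚ[X]) ^ k)] at h1
  have h2 : X * ∑ l ∈ arrangements s, ∑ h ∈ Finset.range (s.card + 1),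
      (if (l.take h).Pairwise (· < ·) then (1 - X : ℚ[X]) ^ (l.take h).length else 0) *
        X ^ listDes (l.drop h) = arrangementSum listDes s + (X - 1) * (1 - X) ^ s.card := by
    rw [← sum_arrangements_increasing s (fun k => (X - 1 : ℚ[X]) * (1 - X) ^ k), arrangementSum,
      ← Finset.sum_add_distrib, Finset.mul_sum]
    refine Finset.sum_congr rfl fun l hl => ?_
    rw [← length_of_mem_arrangements hl]
    exact sum_increasing_prefix_listDes l (mem_arrangements.1 hl).1
  have h3 : ∑ B ∈ s.powerset, (if B.card = 0 then (X : ℚ[X]) else 0) *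
      arrangementSum listDes (s \ B) = X * arrangementSum listDes s := by
    rw [Finset.sum_eq_single_of_mem ∅ (by simp)]
    · simp
    · intro B _ hB
      rw [if_neg (by simpa using hB), zero_mul]
  simp_rw [sub_mul, Finset.sum_sub_distrib, h3, mul_assoc, ← Finset.mul_sum]
  simp_rw [arrangementSum] at h2 ⊢
  rw [← h1, h2]
  ring

/-- Here `B` is the set of letters of the last hook; the factor `X - 1` clears the denominator of
the geometric sum. -/
theorem arrangementSum_listLec (s : Finset ℕ) (hs : 0 ∉ s) :
    (X - 1) * arrangementSum listLec s = (X - 1) +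
      ∑ B ∈ s.powerset, (X ^ B.card - X + if B.card = 0 then X - 1 else 0) *
        arrangementSum listLec (s \ B) := by
  have h1 := sum_arrangements_take_drop s fun u v => (X : ℚ[X]) ^ listLec u * hookWeight v
  have h2 : arrangementSum listLec s = 1 + ∑ l ∈ arrangements s,
      ∑ h ∈ Finset.range (s.card + 1), (X : ℚ[X]) ^ listLec (l.take h) * hookWeight (l.drop h) := by
    rw [← sum_arrangements_increasing s (fun _ => (1 : ℚ[X])), arrangementSum,
      ← Finset.sum_add_distrib]
    refine Finset.sum_congr rfl fun l hl => ?_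
    rw [← length_of_mem_arrangements hl]
    exact pow_listLec_eq l (mem_arrangements.1 hl).1 (ne_zero_of_mem_arrangements hs hl)
  rw [h2, h1, mul_add, mul_one, sum_powerset_sdiff s fun B C =>
    ∑ u ∈ arrangements B, ∑ v ∈ arrangements C, (X : ℚ[X]) ^ listLec u * hookWeight v,
    Finset.mul_sum]
  congr 1
  refine Finset.sum_congr rfl fun B hB => ?_
  rw [← sum_arrangements_hookWeight B fun h => hs (Finset.mem_powerset.1 hB h),
    ← Finset.sum_mul_sum, arrangementSum]
  ring

/-! ### From set recurrences to generating functions -/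

/-- A set function satisfying a recurrence whose coefficients depend on cardinalities only is
itself a function of the cardinality. -/
theorem eq_of_card_eq_of_recurrence {d : ℚ[X]} (hd : d ≠ 0) (a c : ℕ → ℚ[X]) (hc : c 0 = 0)
    (F : Finset ℕ → ℚ[X])
    (hF : ∀ s, 0 ∉ s → d * F s = a s.card + ∑ B ∈ s.powerset, c B.card * F (s \ B))
    (s : Finset ℕ) (hs : 0 ∉ s) : F s = F (Finset.Icc 1 s.card) := by
  induction hn : s.card using Nat.strong_induction_on generalizing s with
  | _ n ih =>
    have key : ∀ t : Finset ℕ, 0 ∉ t → t.card = n → d * F t = a n +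
        ∑ k ∈ Finset.range (n + 1), n.choose k • (c k * F (Finset.Icc 1 (n - k))) := by
      intro t ht htn
      have h := Finset.sum_powerset_apply_card (fun k => c k * F (Finset.Icc 1 (n - k))) (x := t)
      rw [htn] at h
      rw [hF t ht, htn, ← h]
      congr 1
      refine Finset.sum_congr rfl fun B hB => ?_
      have hBt := Finset.mem_powerset.1 hB
      -- `B = ∅` is the only term involving `F t` itself, and `c 0 = 0` removes it.
      rcases Nat.eq_zero_or_pos B.card with h0 | hpos
      · rw [h0, hc, zero_mul, zero_mul]
      · have hcard := Finset.card_sdiff_of_subset hBt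
        have hle := Finset.card_le_card hBt
        rw [htn] at hcard hle
        rw [ih (n - B.card) (by omega) (t \ B) (fun h => ht (Finset.mem_sdiff.1 h).1) hcard]
    exact mul_left_cancel₀ hd ((key s hs hn).trans (key _ (by simp) (by simp)).symm)

/-- The exponential generating function `∑ f n * t ^ n / n!`. -/
noncomputable def egf (f : ℕ → ℚ[X]) : PowerSeries ℚ[X] :=
  PowerSeries.mk fun n => C ((n.factorial : ℚ)⁻¹) * f n

theorem egf_injective : Function.Injective egf := by
  intro f g h
  funext n
  have := congrArg (PowerSeries.coeff n) h
  simp only [egf, PowerSeries.coeff_mk] at this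
  refine mul_left_cancel₀ ?_ this
  simp [Nat.factorial_ne_zero]

theorem egf_mul_egf (c f : ℕ → ℚ[X]) :
    egf c * egf f = egf fun n => ∑ k ∈ Finset.range (n + 1), n.choose k • (c k * f (n - k)) := by
  ext1 n
  rw [PowerSeries.coeff_mul, Finset.Nat.sum_antidiagonal_eq_sum_range_succ_mk]
  simp only [egf, PowerSeries.coeff_mk]
  rw [Finset.mul_sum]
  refine Finset.sum_congr rfl fun k hk => ?_
  have hk : k ≤ n := Nat.lt_succ_iff.1 (Finset.mem_range.1 hk)
  have : ((k.factorial : ℚ)⁻¹ * ((n - k).factorial : ℚ)⁻¹) =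
      (n.factorial : ℚ)⁻¹ * (n.choose k : ℚ) := by
    rw [Nat.cast_choose ℚ hk]
    have := Nat.factorial_ne_zero n
    field_simp
  rw [nsmul_eq_mul, mul_mul_mul_comm, ← C_mul, this, C_mul]
  simp only [map_natCast]
  ring

theorem egf_pow (x : ℚ[X]) :
    egf (fun n => x ^ n) = PowerSeries.rescale x (PowerSeries.exp ℚ[X]) := by
  ext1 n
  rw [PowerSeries.coeff_rescale, PowerSeries.coeff_exp, egf, PowerSeries.coeff_mk, mul_comm]
  simp [Polynomial.algebraMap_eq]

theorem egf_one : egf (fun _ => 1) = PowerSeries.exp ℚ[X] := by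
  simpa using egf_pow 1

theorem egf_add (f g : ℕ → ℚ[X]) : egf (fun n => f n + g n) = egf f + egf g := by
  ext1 n; simp [egf, mul_add]

theorem egf_sub (f g : ℕ → ℚ[X]) : egf (fun n => f n - g n) = egf f - egf g := by
  ext1 n; simp [egf, mul_sub]

theorem egf_const_mul (x : ℚ[X]) (f : ℕ → ℚ[X]) :
    egf (fun n => x * f n) = PowerSeries.C x * egf f := by
  ext1 n; simp [egf, mul_left_comm]

theorem egf_ite_zero (x : ℚ[X]) : egf (fun n => if n = 0 then x else 0) = PowerSeries.C x := by
  ext1 n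
  rw [PowerSeries.coeff_C, egf, PowerSeries.coeff_mk]
  split_ifs with h <;> simp [h]

/-- Grouping subsets by size turns the sum into a binomial convolution, which is a product of
exponential generating functions. -/
theorem egf_recurrence {d : ℚ[X]} (hd : d ≠ 0) (a c : ℕ → ℚ[X]) (hc : c 0 = 0)
    (F : Finset ℕ → ℚ[X])
    (hF : ∀ s, 0 ∉ s → d * F s = a s.card + ∑ B ∈ s.powerset, c B.card * F (s \ B)) :
    PowerSeries.C d * egf (fun n => F (Finset.Icc 1 n)) =
      egf a + egf c * egf fun n => F (Finset.Icc 1 n) := by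
  rw [egf_mul_egf, ← egf_add, ← egf_const_mul]
  congr 1
  funext n
  have h := Finset.sum_powerset_apply_card (fun k => c k * F (Finset.Icc 1 (n - k)))
    (x := Finset.Icc 1 n)
  rw [Nat.card_Icc, Nat.add_sub_cancel] at h
  rw [hF _ (by simp), ← h, Nat.card_Icc, Nat.add_sub_cancel]
  congr 1
  refine Finset.sum_congr rfl fun B hB => ?_
  rw [eq_of_card_eq_of_recurrence hd a c hc F hF (Finset.Icc 1 n \ B) (by simp),
    Finset.card_sdiff_of_subset (Finset.mem_powerset.1 hB), Nat.card_Icc, Nat.add_sub_cancel]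

theorem X_sub_one_ne_zero : (X - 1 : ℚ[X]) ≠ 0 := by
  simpa using X_sub_C_ne_zero (1 : ℚ)

theorem arrangementSum_listLec_eq_listDes (n : ℕ) :
    arrangementSum listLec (Finset.Icc 1 n) = arrangementSum listDes (Finset.Icc 1 n) := by
  refine congrFun (egf_injective ?_ : (fun n => arrangementSum listLec (Finset.Icc 1 n)) =
    fun n => arrangementSum listDes (Finset.Icc 1 n)) n
  have hL := egf_recurrence X_sub_one_ne_zero (fun _ => (X - 1) * 1)
    (fun k => X ^ k - X * 1 + if k = 0 then X - 1 else 0) (by simp) (arrangementSum listLec)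
    (by simpa using arrangementSum_listLec)
  have hD := egf_recurrence X_sub_one_ne_zero (fun k => (X - 1) * (1 - X) ^ k)
    (fun k => (if k = 0 then X else 0) - X * (1 - X) ^ k) (by simp) (arrangementSum listDes)
    (fun s _ => arrangementSum_listDes s)
  rw [egf_add, egf_sub, egf_ite_zero, egf_const_mul, egf_const_mul, egf_pow, egf_one] at hL
  rw [egf_sub, egf_ite_zero, egf_const_mul, egf_const_mul, egf_pow] at hD
  generalize egf (fun n => arrangementSum listLec (Finset.Icc 1 n)) = L at *
  generalize egf (fun n => arrangementSum listDes (Finset.Icc 1 n)) = D at *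
  have hexp := PowerSeries.exp_mul_exp_eq_exp_add (X : ℚ[X]) (1 - X)
  rw [add_sub_cancel, PowerSeries.rescale_one, RingHom.id_apply] at hexp
  have hcc : ∀ x : ℚ[X], PowerSeries.constantCoeff
      (PowerSeries.rescale x (PowerSeries.exp ℚ[X])) = 1 := by
    intro x
    rw [← PowerSeries.coeff_zero_eq_constantCoeff_apply, PowerSeries.coeff_rescale]
    simp
  have h1 := hcc X
  have h2 := hcc (1 - X)
  generalize PowerSeries.rescale (X : ℚ[X]) (PowerSeries.exp ℚ[X]) = E at *
  generalize PowerSeries.rescale (1 - X : ℚ[X]) (PowerSeries.exp ℚ[X]) = K at *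
  rw [← hexp] at hL
  simp only [map_sub, map_one] at hL hD
  -- The second factor has constant term `X - 1`, so it can be cancelled.
  have hne : E * (PowerSeries.C (X : ℚ[X]) * K - 1) ≠ 0 := by
    refine mul_ne_zero ?_ ?_
    · rintro rfl; simp at h1
    · intro h
      have := congrArg PowerSeries.constantCoeff h
      simp only [map_sub, map_mul, h2, PowerSeries.constantCoeff_C, map_one, map_zero,
        mul_one] at this
      exact X_sub_one_ne_zero this
  refine mul_right_cancel₀ hne ?_
  linear_combination hL - E * hD

/-! ### Permutations -/

theorem oneLine_injective {n : ℕ} : Function.Injective (oneLine (n := n)) := by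
  intro σ τ h
  ext i
  have := congrFun (List.ofFn_injective h) i
  omega

/-- One inclusion suffices, since both sides have `n!` elements. -/
theorem image_oneLine (n : ℕ) :
    Finset.univ.image (oneLine (n := n)) = arrangements (Finset.Icc 1 n) := by
  refine Finset.eq_of_subset_of_card_le ?_ ?_
  · intro l hl
    obtain ⟨σ, -, rfl⟩ := Finset.mem_image.1 hl
    have hnd : (oneLine σ).Nodup := by
      refine List.nodup_ofFn.2 fun i j h => σ.injective (Fin.ext ?_)
      simpa using h
    refine mem_arrangements.2 ⟨hnd, Finset.eq_of_subset_of_card_le ?_ ?_⟩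
    · intro x hx
      rw [List.mem_toFinset, oneLine, List.mem_ofFn] at hx
      obtain ⟨i, rfl⟩ := hx
      have := (σ i).isLt
      rw [Finset.mem_Icc]
      omega
    · rw [List.toFinset_card_of_nodup hnd, oneLine, List.length_ofFn, Nat.card_Icc]
      omega
  · rw [card_arrangements, Finset.card_image_of_injective _ oneLine_injective, Finset.card_univ,
      Fintype.card_perm, Fintype.card_fin, Nat.card_Icc, Nat.add_sub_cancel]

theorem sum_perm_oneLine (n : ℕ) (stat : List ℕ → ℕ) :
    ∑ σ : Equiv.Perm (Fin n), (X : ℚ[X]) ^ stat (oneLine σ) =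
      arrangementSum stat (Finset.Icc 1 n) := by
  rw [arrangementSum, ← image_oneLine, Finset.sum_image oneLine_injective.injOn]

theorem sum_pow_lec_eq_sum_pow_des (n : ℕ) :
    ∑ σ : Equiv.Perm (Fin n), (X : ℚ[X]) ^ lec σ = ∑ σ : Equiv.Perm (Fin n), X ^ des σ := by
  simp_rw [des_eq_listDes]
  rw [sum_perm_oneLine n listDes, ← arrangementSum_listLec_eq_listDes, ← sum_perm_oneLine]
  rfl

theorem coeff_sum_pow {ι : Type*} (s : Finset ι) (f : ι → ℕ) (k : ℕ) :
    (∑ i ∈ s, (X : ℚ[X]) ^ f i).coeff k = ((s.filter fun i => f i = k).card : ℚ) := by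
  simp [Polynomial.finsetSum_coeff, coeff_X_pow, Finset.sum_boole, eq_comm]

end LecDes

theorem mainTheorem4 :
    LecDes.lecEGF = LecDes.desEGF ∧
      ∀ n k : ℕ,
        (Finset.univ.filter fun σ : Equiv.Perm (Fin n) => LecDes.lec σ = k).card =
          (Finset.univ.filter fun σ : Equiv.Perm (Fin n) => LecDes.des σ = k).card := by
  constructor
  · simp only [LecDes.lecEGF, LecDes.desEGF, LecDes.statEGF, LecDes.sum_pow_lec_eq_sum_pow_des]
  · intro n k
    have h := congrArg (fun p => Polynomial.coeff p k) (LecDes.sum_pow_lec_eq_sum_pow_des n)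
    simp only [LecDes.coeff_sum_pow] at h
    exact_mod_cast h
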